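/- **Conventions.** A *locale* (or frame) $L$ is a complete lattice in which $x\wedge\bigvee S=\bigvee\{x\wedge s\mid s\in S\}$ for all $x\in L$, $S\subseteq L$; its top is $1$, its bottom is $0$. A *sublocale* of $L$ is a subset closed under arbitrary meets and under $x\to(-)$ for every $x\in L$. Sublocales are ordered by inclusion; meets are intersections, $\bigvee_i S_i=\{\bigwedge M\mid M\subseteq\bigcup_i S_i\}$, and $\emptyset$ denotes the void sublocale $\{1\}$; "non-void" means $\neq\{1\}$, and two sublocales are disjoint if their intersection is $\emptyset$. For $a\in L$ put $\mathfrak o(a)=\{x\mid a\to x=x\}$ (open sublocales) and $\mathfrak c(a)=\{x\mid a\le x\}$ (closed sublocales). $L\setminus S$ denotes the smallest sublocale $T$ with $S\vee T=L$; $S$ is *complemented* if $S\cap(L\setminus S)=\emptyset$. The *closure* is $\overline S=\mathfrak c(\bigwedge S)$, the *interior* $\operatorname{int}S$ is the join of the open sublocales contained in $S$, and the *boundary* is $\partial S=\overline S\setminus\operatorname{int}S$, that is, the intersection of $\overline S$ with the complement of the (open) sublocale $\operatorname{int}S$. A *separation* of a sublocale $S$ is an inclusion $S\subseteq\mathfrak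 c(a)\vee\mathfrak c(b)$ with $S\cap\mathfrak c(a)\cap\mathfrak c(b)=\emptyset$, $S\cap\mathfrak c(a)\ne\emptyset$ and $S\cap\mathfrak c(b)\neq\emptyset$. $S$ is *connected* if it has no separation (so $\emptyset$ is connected). A *continuum* is a non-void closed connected sublocale; a *region* is a non-void open connected sublocale. A *component* of a sublocale $T$ is a non-void connected sublocale $D\subseteq T$ such that $S\subseteq D$ for every connected sublocale $S\subseteq T$ with $S\cap D\ne\emptyset$. A sublocale $C$ is *simple* if it is complemented and both $C$ and $L\setminus C$ are connected. A complemented sublocale $S$ *separates the elements $x,y\in L$* if $L\setminus S$ has a separation $L\setminus S\subseteq\mathfrak c(a)\vee\mathfrak c(b)$ with $x\in(L\setminus S)\cap\mathfrak c(a)$ and $y\in(L\setminus S)\cap\mathfrak c(b)$; it *separates the sublocales $X$ and $Y$* if it separates every $x\in X$ from every $y\in Y$. An element $x\in L$ is *connected* if $x=b\vee c$ and $b\wedge c=0$ imply $b=0$ or $c=0$; $L$ is *connected* if $1$ is connected, and *locally connected* if every element is a join of connected elements. **Theorem 5.1.** Let $L$ be a connected and locally connected locale. The following properties are equivalent: -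 (I) Whenever $X,Y$ are non-void sublocales of $L$ and $u,v\in L$ are such that $\mathfrak c(u)\cap\mathfrak c(v)=\emptyset$ and neither $\mathfrak c(u)$ nor $\mathfrak c(v)$ separates any element $x\neq1$ of $X$ from any element $y\ne1$ of $Y$, then $\mathfrak c(u)\vee\mathfrak c(v)$ does not separate $X$ and $Y$. - (II) (Brouwer property) If $\mathfrak c(u)$ is a continuum, then $\partial D$ is a continuum for every component $D$ of $L\setminus\mathfrak c(u)$. - (III) (Unicoherence) Whenever $L=H\vee K$ with $H,K$ continua, $H\cap K$ is a continuum. - (IV) If $\mathfrak c(u)$ is non-void and $D_1,D_2$ are disjoint components of $L\setminus\mathfrak c(u)$ with $\partial D_1=\partial D_2$, then $\partial D_1$ is a continuum. - (V) If $C,D$ are disjoint complemented connected sublocales with $\partial C\subseteq\partial D$, then $\partial C$ is connected. - (VI) If $C$ is a simple sublocale, then $\partial C$ is connected. - (VII) If $R$ is a simple region, then $\partial R$ is connected. - (VIII) If $A,B$ are disjoint regions with $\partial A=\partial B$, then $\partial A$ is connected. - (IX) If $A,B$ are regions with $\partial A\cap\partial B=\emptyset$, then $A\cap B$ is connected. -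 (X) (Open unicoherence) Whenever $L=A\vee B$ with $A,B$ regions, $A\cap B$ is a region. -/

import Mathlib

universe u

namespace Sublocale

variable {L : Type u} [Order.Frame L]

/-! The lattice of sublocales of `L` is Mathlib's `Sublocale L`, ordered by inclusion: `⊥` is the void
sublocale `{⊤}`, `⊤` is `L` itself, `⊓` is intersection, `⊔` is the join of sublocales. It is a
coframe, and `⊤ \ S` is the smallest sublocale `T` with `S ⊔ T = ⊤`: the supplement of `S`, which is
the complement `L ∖ S` when `S` is complemented. -/

/-- The open sublocale `𝔬(a) = {x | a ⇨ x = x}`. -/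
def openSub (a : L) : Sublocale L where
  carrier := {x | a ⇨ x = x}
  sInf_mem' s hs := by
    refine le_antisymm (le_sInf fun x hx => ?_) le_himp
    have h : a ⇨ x = x := hs hx
    exact (himp_le_himp_left (sInf_le hx)).trans h.le
  himp_mem' b x hx := by
    have h : a ⇨ x = x := hx
    change a ⇨ (b ⇨ x) = b ⇨ x
    rw [himp_left_comm, h]

/-- The closed sublocale `𝔠(a) = ↑a`. -/
def closedSub (a : L) : Sublocale L where
  carrier := {x | a ≤ x}
  sInf_mem' _ hs := le_sInf fun _ hx => hs hx
  himp_mem' _ _ hx := le_trans hx le_himp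

/-- The closure `↑(⋀ S)`. -/
def closure (S : Sublocale L) : Sublocale L := closedSub (sInf (S : Set L))

/-- The interior: the join of all open sublocales contained in `S`. -/
def interior (S : Sublocale L) : Sublocale L := sSup {U | (∃ a, U = openSub a) ∧ U ≤ S}

/-- The boundary: closure minus interior. -/
def boundary (S : Sublocale L) : Sublocale L := S.closure \ S.interior

/-- `S ⊆ 𝔠(a) ∨ 𝔠(b)` is a separation of `S`: the traces of `𝔠(a)` and `𝔠(b)` on `S` cover `S`, are
disjoint, and are both non-void. -/
def IsSeparation (S : Sublocale L) (a b : L) : Prop :=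
  S ≤ closedSub a ⊔ closedSub b ∧ S ⊓ closedSub a ⊓ closedSub b = ⊥ ∧
    S ⊓ closedSub a ≠ ⊥ ∧ S ⊓ closedSub b ≠ ⊥

/-- A sublocale is connected if it admits no separation (the void sublocale is connected). -/
def IsConnected (S : Sublocale L) : Prop := ∀ a b : L, ¬ S.IsSeparation a b

/-- A continuum: a non-void closed connected sublocale. -/
def IsContinuum (S : Sublocale L) : Prop := S ≠ ⊥ ∧ (∃ a, S = closedSub a) ∧ S.IsConnected

/-- A region: a non-void open connected sublocale. -/
def IsRegion (S : Sublocale L) : Prop := S ≠ ⊥ ∧ (∃ a, S = openSub a) ∧ S.IsConnected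

/-- `D` is a component of `T`. -/
def IsComponentOf (D T : Sublocale L) : Prop :=
  D ≠ ⊥ ∧ D ≤ T ∧ D.IsConnected ∧
    ∀ S : Sublocale L, S ≤ T → S.IsConnected → S ⊓ D ≠ ⊥ → S ≤ D

/-- A simple sublocale: complemented, connected, with connected complement. -/
def IsSimple (C : Sublocale L) : Prop :=
  IsComplemented C ∧ C.IsConnected ∧ (⊤ \ C).IsConnected

/-- The (complemented) sublocale `S` separates the elements `x` and `y` in `L`: the complement of `S`
admits a separation (hence is not connected) with `x` on one side and `y` on the other. -/
def SeparatesElements (S : Sublocale L) (x y : L) : Prop :=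
  ∃ a b : L, (⊤ \ S).IsSeparation a b ∧
    x ∈ (⊤ \ S) ⊓ closedSub a ∧ y ∈ (⊤ \ S) ⊓ closedSub b

/-- `S` separates the sublocales `X` and `Y` in `L`. -/
def Separates (S X Y : Sublocale L) : Prop :=
  ∀ x ∈ X, ∀ y ∈ Y, S.SeparatesElements x y

end Sublocale

namespace Order.Frame

/-- A connected element of a frame. -/
def IsConnectedElement {L : Type u} [Order.Frame L] (x : L) : Prop :=
  ∀ b c : L, x = b ⊔ c → b ⊓ c = ⊥ → b = ⊥ ∨ c = ⊥

/-- A locale is connected if its top element is connected. -/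
def IsConnected (L : Type u) [Order.Frame L] : Prop := IsConnectedElement (⊤ : L)

/-- A locale is locally connected if every element is a join of connected elements. -/
def IsLocallyConnected (L : Type u) [Order.Frame L] : Prop :=
  ∀ x : L, ∃ s : Set L, (∀ y ∈ s, IsConnectedElement y) ∧ x = sSup s

/-- Unicoherence. -/
def IsUnicoherent (L : Type u) [Order.Frame L] : Prop :=
  ∀ H K : Sublocale L, H.IsContinuum → K.IsContinuum → ⊤ = H ⊔ K → (H ⊓ K).IsContinuum

/-- Open unicoherence. -/
def IsOpenUnicoherent (L : Type u) [Order.Frame L] : Prop :=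
  ∀ A B : Sublocale L, A.IsRegion → B.IsRegion → ⊤ = A ⊔ B → (A ⊓ B).IsRegion

end Order.Frame

/-!
The proof translates all the properties into the frame `L`. The closed sublocale `𝔠(a)` is connected
iff the frame `↑a` is (`IsCoconnected a`), the boundary of `𝔬(a)` is `𝔠(a ⊔ aᶜ)`, and by local
connectedness the components of `𝔬(u)` are the `𝔬(d)` for `d` a nonzero connected direct summand of
`u` (`IsComponent d u`). A splitting of a closed sublocale `𝔠(t)` is then a pair `p`, `q` with
`p ⊓ q = t`, `p ⊔ q = ⊤` and `p, q ≠ ⊤`.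

The hub is the property that simple regions have connected boundary: `r ⊔ rᶜ` is coconnected
whenever `r` is connected and coconnected.
* It is equivalent to the Brouwer property, because a component of the complement of a continuum has
  connected complement (`IsComponent.isCoconnected`).
* It gives unicoherence: if `H ∩ K` splits into `P` and `Q`, each component of the complement of `H`
  has its connected boundary in `P` or in `Q`, and sorting the components accordingly splits `K`
  (`IsCoconnected.sup_of_forall_isComponent`).
* Unicoherence, applied to the closures of `C` and of its complement, shows that `∂C` is connected
  if `∂C ⊆ ∂D` for some `D` disjoint from `C` (`isConnected_boundary_of_unicoherent`). This
  specialises to simple sublocales, and to disjoint regions or components with equal boundaries.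
* The case of components with equal boundaries gives back the hub property by the same sorting: a
  component of the exterior of `R` shares its boundary with a component of its own exterior
  (`IsCoconnected.sup_compl_of_forall_disjoint`).
* For regions `A`, `B` with disjoint boundaries, let `P` be a component of `A ∩ B` and `D` a component
  of the exterior of `P` that meets `A ∩ B`. By the hub property the boundary of `D` is connected; it
  lies in the disjoint union of `∂A` and `∂B`, hence in one of them, so `D` splits `A` or `B`. Thus
  `A ∩ B` has no second component (`IsConnectedElement.inf_of_forall_isCoconnected`).
* This yields the statement on separation by `𝔠(u) ∨ 𝔠(v)`, by passing to components of `𝔬(u)` and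
  `𝔬(v)` (`not_separates_of_forall_inf`); open unicoherence is the case in which `𝔬(u)` and `𝔬(v)`
  are connected (`isConnectedElement_inf_of_not_separates`).
* Open unicoherence gives back the hub property: when the boundary of `R` splits into `P` and `Q`, the
  components of `L ∖ P` and `L ∖ Q` that contain `R` cover `L` and meet in `R` alone, which splits the
  complement of `R` (`IsCoconnected.sup_compl_of_openUnicoherent`).
-/

/-! ### Open and closed sublocales -/

namespace Sublocale

variable {L : Type u} [Order.Frame L] {S T : Sublocale L} {a b x : L}

lemma mem_bot_iff : x ∈ (⊥ : Sublocale L) ↔ x = ⊤ := by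
  refine ⟨fun h => ?_, fun h => h ▸ top_mem⟩
  exact (bot_le : (⊥ : Sublocale L) ≤ ⟨{⊤}, fun s hs => by
    simpa [sInf_eq_top] using hs, fun a b hb => by
    rw [Set.mem_singleton_iff] at hb ⊢; simp [hb]⟩) h

lemma mem_inf_iff : x ∈ S ⊓ T ↔ x ∈ S ∧ x ∈ T := by
  refine ⟨fun h => ⟨(inf_le_left : S ⊓ T ≤ S) h, (inf_le_right : S ⊓ T ≤ T) h⟩, fun h => ?_⟩
  have : (⟨{x | x ∈ S ∧ x ∈ T}, fun s hs => ⟨sInf_mem fun y hy => (hs hy).1,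
    sInf_mem fun y hy => (hs hy).2⟩, fun a b hb => ⟨himp_mem hb.1, himp_mem hb.2⟩⟩ :
      Sublocale L) ≤ S ⊓ T := le_inf (fun y hy => hy.1) (fun y hy => hy.2)
  exact this h

lemma ne_bot_iff : S ≠ ⊥ ↔ ∃ x ∈ S, x ≠ ⊤ := by
  constructor
  · intro h
    by_contra! hc
    exact h (le_bot_iff.1 fun x hx => mem_bot_iff.2 (hc x hx))
  · rintro ⟨x, hx, hne⟩ rfl
    exact hne (mem_bot_iff.1 hx)

lemma mem_openSub_iff : x ∈ openSub a ↔ a ⇨ x = x := Iff.rfl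

lemma mem_closedSub_iff : x ∈ closedSub a ↔ a ≤ x := Iff.rfl

lemma isCompl_openSub_closedSub (a : L) : IsCompl (openSub a) (closedSub a) := by
  refine IsCompl.of_eq (le_bot_iff.1 fun x hx => ?_) (top_le_iff.1 fun x _ => ?_)
  · obtain ⟨h₁, h₂⟩ := mem_inf_iff.1 hx
    rw [mem_openSub_iff] at h₁
    rw [mem_bot_iff, ← h₁, himp_eq_top_iff]
    exact h₂
  · have h₁ : a ⇨ x ∈ openSub a ⊔ closedSub a :=
      (le_sup_left : openSub a ≤ _) (mem_openSub_iff.2 (by simp))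
    have h₂ : a ⊔ x ∈ openSub a ⊔ closedSub a :=
      (le_sup_right : closedSub a ≤ _) (mem_closedSub_iff.2 le_sup_left)
    have h : x = (a ⇨ x) ⊓ (a ⊔ x) := by
      refine le_antisymm (le_inf le_himp le_sup_right) ?_
      rw [inf_sup_left, himp_inf_self]
      exact sup_le inf_le_left inf_le_right
    rw [h]
    exact inf_mem h₁ h₂

lemma closedSub_inf_closedSub (a b : L) : closedSub a ⊓ closedSub b = closedSub (a ⊔ b) := by
  ext x; simp [mem_inf_iff, mem_closedSub_iff]

lemma closedSub_sup_closedSub (a b : L) : closedSub a ⊔ closedSub b = closedSub (a ⊓ b) := by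
  refine le_antisymm (sup_le (fun x hx => inf_le_left.trans hx)
    (fun x hx => inf_le_right.trans hx)) fun x (hx : a ⊓ b ≤ x) => ?_
  have h₁ : x ⊔ a ∈ closedSub a ⊔ closedSub b :=
    (le_sup_left : closedSub a ≤ _) (mem_closedSub_iff.2 le_sup_right)
  have h₂ : x ⊔ b ∈ closedSub a ⊔ closedSub b :=
    (le_sup_right : closedSub b ≤ _) (mem_closedSub_iff.2 le_sup_right)
  have h := inf_mem h₁ h₂
  rwa [← sup_inf_left, sup_eq_left.2 hx] at h

lemma closedSub_le_closedSub : closedSub a ≤ closedSub b ↔ b ≤ a :=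
  ⟨fun h => h (le_refl a), fun h _ hx => h.trans hx⟩

lemma closedSub_injective : Function.Injective (closedSub : L → Sublocale L) := fun _ _ h =>
  le_antisymm (closedSub_le_closedSub.1 h.ge) (closedSub_le_closedSub.1 h.le)

lemma le_closedSub_iff : S ≤ closedSub a ↔ a ≤ sInf (S : Set L) :=
  ⟨fun h => le_sInf fun _ hx => h hx, fun h _ hx => h.trans (sInf_le hx)⟩

lemma closedSub_bot : closedSub (⊥ : L) = ⊤ := top_le_iff.1 fun _ _ => bot_le

lemma closedSub_eq_top_iff : closedSub a = ⊤ ↔ a = ⊥ := by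
  rw [← closedSub_bot, closedSub_injective.eq_iff]

lemma closedSub_top : closedSub (⊤ : L) = ⊥ :=
  le_bot_iff.1 fun _ hx => mem_bot_iff.2 (top_le_iff.1 hx)

lemma closedSub_eq_bot_iff : closedSub a = ⊥ ↔ a = ⊤ := by
  rw [← closedSub_top, closedSub_injective.eq_iff]

lemma le_openSub_iff : S ≤ openSub a ↔ S ⊓ closedSub a = ⊥ := by
  rw [← disjoint_iff, (isCompl_openSub_closedSub a).disjoint_right_iff]

lemma le_closedSub_iff_inf_openSub : S ≤ closedSub a ↔ S ⊓ openSub a = ⊥ := by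
  rw [← disjoint_iff, (isCompl_openSub_closedSub a).symm.disjoint_right_iff]

lemma openSub_le_openSub : openSub a ≤ openSub b ↔ a ≤ b := by
  rw [(isCompl_openSub_closedSub b).le_left_iff, disjoint_comm,
    (isCompl_openSub_closedSub a).disjoint_left_iff,
    closedSub_le_closedSub]

lemma openSub_injective : Function.Injective (openSub : L → Sublocale L) := fun _ _ h =>
  le_antisymm (openSub_le_openSub.1 h.le) (openSub_le_openSub.1 h.ge)

lemma openSub_top : openSub (⊤ : L) = ⊤ := top_le_iff.1 fun x _ => by simp [mem_openSub_iff]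

lemma openSub_bot : openSub (⊥ : L) = ⊥ :=
  le_bot_iff.1 fun x hx => by
    have h : (⊥ : L) ⇨ x = x := hx
    rw [mem_bot_iff, ← h, bot_himp]

lemma openSub_eq_bot_iff : openSub a = ⊥ ↔ a = ⊥ := by
  rw [← openSub_bot, openSub_injective.eq_iff]

lemma openSub_inf_openSub (a b : L) : openSub a ⊓ openSub b = openSub (a ⊓ b) := by
  have h := (isCompl_openSub_closedSub a).inf_sup (isCompl_openSub_closedSub b)
  rw [closedSub_sup_closedSub] at h
  exact h.left_unique (isCompl_openSub_closedSub _)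

lemma openSub_sup_openSub (a b : L) : openSub a ⊔ openSub b = openSub (a ⊔ b) := by
  have h := (isCompl_openSub_closedSub a).sup_inf (isCompl_openSub_closedSub b)
  rw [closedSub_inf_closedSub] at h
  exact h.left_unique (isCompl_openSub_closedSub _)

lemma top_sdiff_eq_of_isCompl (h : IsCompl S T) : ⊤ \ S = T := by
  rw [top_sdiff', h.hnot_eq]

lemma top_sdiff_closedSub (a : L) : ⊤ \ closedSub a = openSub a :=
  top_sdiff_eq_of_isCompl (isCompl_openSub_closedSub a).symm

lemma top_sdiff_openSub (a : L) : ⊤ \ openSub a = closedSub a :=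
  top_sdiff_eq_of_isCompl (isCompl_openSub_closedSub a)

/-! ### Boundaries -/

lemma sInf_openSub (a : L) : sInf (openSub a : Set L) = aᶜ := by
  refine eq_of_forall_le_iff fun b => ?_
  rw [← le_closedSub_iff, le_closedSub_iff_inf_openSub, openSub_inf_openSub, openSub_eq_bot_iff,
    le_compl_iff_disjoint_left, disjoint_iff]

lemma sInf_closedSub (a : L) : sInf (closedSub a : Set L) = a :=
  le_antisymm (sInf_le (le_refl a)) (le_sInf fun _ hx => hx)

/-- The interior of a complemented sublocale is the complement of the closure of its complement. -/
lemma interior_eq_of_isCompl (h : IsCompl S T) : S.interior = openSub (sInf (T : Set L)) := by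
  have key : ∀ a, openSub a ≤ S ↔ a ≤ sInf (T : Set L) := fun a => by
    rw [← le_closedSub_iff, le_closedSub_iff_inf_openSub, inf_comm, ← disjoint_iff,
      h.disjoint_right_iff]
  refine le_antisymm (sSup_le ?_) (le_sSup ⟨⟨_, rfl⟩, (key _).2 le_rfl⟩)
  rintro _ ⟨⟨a, rfl⟩, ha⟩
  exact openSub_le_openSub.2 ((key a).1 ha)

lemma sdiff_openSub (S : Sublocale L) (a : L) : S \ openSub a = S ⊓ closedSub a := by
  have h := isCompl_openSub_closedSub a
  refine le_antisymm ?_ ?_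
  · rw [sdiff_le_iff, sup_inf_left, h.sup_eq_top, inf_top_eq]
    exact le_sup_right
  · calc S ⊓ closedSub a ≤ (S \ openSub a ⊔ openSub a) ⊓ closedSub a :=
          inf_le_inf_right _ (by rw [sdiff_sup_self]; exact le_sup_left)
      _ ≤ S \ openSub a := by
          rw [inf_sup_right, h.inf_eq_bot, sup_bot_eq]
          exact inf_le_left

/-- The boundary of a complemented sublocale is the intersection of the closures of the sublocale
and of its complement. -/
lemma boundary_eq_of_isCompl (h : IsCompl S T) :
    S.boundary = closedSub (sInf (S : Set L) ⊔ sInf (T : Set L)) := by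
  rw [boundary, interior_eq_of_isCompl h, closure, sdiff_openSub, closedSub_inf_closedSub]

lemma boundary_openSub (a : L) : (openSub a).boundary = closedSub (a ⊔ aᶜ) := by
  rw [boundary_eq_of_isCompl (isCompl_openSub_closedSub a), sInf_openSub, sInf_closedSub, sup_comm]

lemma boundary_le_closure (S : Sublocale L) : S.boundary ≤ closedSub (sInf (S : Set L)) :=
  sdiff_le

end Sublocale

namespace Order.Frame

variable {L : Type u} [Order.Frame L]

/-! ### Connected elements and their components -/

lemma le_of_le_sup_of_inf_le {x y z w : L} (h : x ≤ y ⊔ z) (hy : x ⊓ y ≤ w) (hz : x ⊓ z ≤ w) :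
    x ≤ w := by
  rw [← inf_eq_left.2 h, inf_sup_left]
  exact sup_le hy hz

lemma IsConnectedElement.le_or_le {e b c : L} (he : IsConnectedElement e) (h : e ≤ b ⊔ c)
    (hbc : e ⊓ b ⊓ c = ⊥) : e ≤ b ∨ e ≤ c := by
  have h₁ : e = e ⊓ b ⊔ e ⊓ c := by rw [← inf_sup_left, inf_eq_left.2 h]
  have h₂ : e ⊓ b ⊓ (e ⊓ c) = ⊥ := by
    rw [← le_bot_iff, ← hbc]
    exact le_inf inf_le_left (inf_le_right.trans inf_le_right)
  rcases he _ _ h₁ h₂ with h | h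
  · exact Or.inr (le_of_le_sup_of_inf_le (by assumption) (by simp [h]) inf_le_right)
  · exact Or.inl (le_of_le_sup_of_inf_le (by assumption) inf_le_right (by simp [h]))

lemma IsConnectedElement.le_or_le_of_le_sup_compl {e b : L} (he : IsConnectedElement e)
    (h : e ≤ b ⊔ bᶜ) : e ≤ b ∨ e ≤ bᶜ :=
  he.le_or_le h (by rw [inf_assoc, inf_compl_self, inf_bot_eq])

lemma isConnectedElement_sSup {s : Set L} (hs : ∀ x ∈ s, IsConnectedElement x) {e : L}
    (he : e ∈ s) (hm : ∀ x ∈ s, x ⊓ e ≠ ⊥) : IsConnectedElement (sSup s) := by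
  have key : ∀ b c : L, sSup s = b ⊔ c → b ⊓ c = ⊥ → e ≤ b → c = ⊥ := by
    intro b c hbc h0 heb
    have hle : sSup s ≤ b := by
      refine sSup_le fun x hx => ?_
      have h1 : x ≤ b ⊔ c := hbc ▸ le_sSup hx
      refine ((hs x hx).le_or_le h1 (by rw [inf_assoc, h0, inf_bot_eq])).resolve_right fun hxc => ?_
      refine hm x hx (le_bot_iff.1 ?_)
      rw [← h0, inf_comm]
      exact inf_le_inf heb hxc
    rw [← le_bot_iff, ← h0]
    exact le_inf ((hbc ▸ le_sup_right : c ≤ sSup s).trans hle) le_rfl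
  intro b c hbc h0
  have h1 : e ≤ b ⊔ c := hbc ▸ le_sSup he
  rcases (hs e he).le_or_le h1 (by rw [inf_assoc, h0, inf_bot_eq]) with h | h
  · exact Or.inr (key b c hbc h0 h)
  · exact Or.inl (key c b (by rw [hbc, sup_comm]) (by rw [inf_comm, h0]) h)

lemma IsConnectedElement.sup {a b : L} (ha : IsConnectedElement a) (hb : IsConnectedElement b)
    (h : a ⊓ b ≠ ⊥) : IsConnectedElement (a ⊔ b) := by
  rw [← sSup_pair]
  have h0 : b ≠ ⊥ := fun h' => h (by simp [h'])
  refine isConnectedElement_sSup (e := b) ?_ (by simp) ?_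
  · rintro x (rfl | rfl) <;> assumption
  · rintro x (rfl | rfl)
    · exact h
    · simpa using h0

/-- `d` is a component of `u`: a nonzero connected element that is a direct summand of `u`. In a
locally connected frame these are exactly the maximal nonzero connected elements below `u`. -/
def IsComponent (d u : L) : Prop :=
  d ≠ ⊥ ∧ IsConnectedElement d ∧ ∃ e, d ⊔ e = u ∧ d ⊓ e = ⊥

lemma IsComponent.le {d u : L} (h : IsComponent d u) : d ≤ u := by
  obtain ⟨-, -, e, rfl, -⟩ := h
  exact le_sup_left

lemma IsComponent.le_of_inf_ne_bot {d u x : L} (h : IsComponent d u) (hx : IsConnectedElement x)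
    (hxu : x ≤ u) (hm : x ⊓ d ≠ ⊥) : x ≤ d := by
  obtain ⟨-, -, e, rfl, h0⟩ := h
  refine (hx.le_or_le hxu (by rw [inf_assoc, h0, inf_bot_eq])).resolve_right fun hxe => hm ?_
  rw [← le_bot_iff, ← h0, inf_comm]
  exact inf_le_inf_left _ hxe

lemma IsComponent.eq_of_inf_ne_bot {d e u : L} (hd : IsComponent d u) (he : IsComponent e u)
    (hm : d ⊓ e ≠ ⊥) : d = e :=
  le_antisymm (he.le_of_inf_ne_bot hd.2.1 hd.le hm)
    (hd.le_of_inf_ne_bot he.2.1 he.le (by rwa [inf_comm]))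

lemma IsComponent.le_sup_compl {d u : L} (h : IsComponent d u) : u ≤ d ⊔ dᶜ := by
  obtain ⟨-, -, e, rfl, h0⟩ := h
  exact sup_le_sup_left (le_compl_iff_disjoint_left.2 (disjoint_iff.2 h0)) _

lemma IsComponent.sup_compl_self {a : L} (ha : IsConnectedElement a) (h0 : a ≠ ⊥) :
    IsComponent a (a ⊔ aᶜ) :=
  ⟨h0, ha, aᶜ, rfl, inf_compl_self a⟩

lemma IsComponent.self {a : L} (ha : IsConnectedElement a) (h0 : a ≠ ⊥) : IsComponent a a :=
  ⟨h0, ha, ⊥, sup_bot_eq a, inf_bot_eq a⟩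

lemma IsComponent.sup_right {d u v : L} (h : IsComponent d u) (huv : u ⊓ v = ⊥) :
    IsComponent d (u ⊔ v) := by
  obtain ⟨h1, h2, e, rfl, h0⟩ := h
  refine ⟨h1, h2, e ⊔ v, by rw [sup_assoc], ?_⟩
  rw [inf_sup_left, h0, bot_sup_eq, ← le_bot_iff, ← huv]
  exact inf_le_inf_right _ le_sup_left

lemma IsLocallyConnected.le_of_forall (hloc : IsLocallyConnected L) {u x : L}
    (h : ∀ e, IsConnectedElement e → e ≤ u → e ≤ x) : u ≤ x := by
  obtain ⟨s, hs, rfl⟩ := hloc u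
  exact sSup_le fun e he => h e (hs e he) (le_sSup he)

lemma IsLocallyConnected.exists_not_le (hloc : IsLocallyConnected L) {u x : L} (h : ¬ u ≤ x) :
    ∃ e, IsConnectedElement e ∧ e ≤ u ∧ ¬ e ≤ x := by
  contrapose! h
  exact hloc.le_of_forall h

lemma IsLocallyConnected.exists_isComponent (hloc : IsLocallyConnected L) {u e : L}
    (he : IsConnectedElement e) (h0 : e ≠ ⊥) (heu : e ≤ u) : ∃ d, IsComponent d u ∧ e ≤ d := by
  set s : Set L := {x | IsConnectedElement x ∧ x ≤ u ∧ x ⊓ e ≠ ⊥} with hs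
  have hes : e ∈ s := ⟨he, heu, by simpa using h0⟩
  have hed : e ≤ sSup s := le_sSup hes
  have hdu : sSup s ≤ u := sSup_le fun x hx => hx.2.1
  refine ⟨sSup s, ⟨fun h => h0 (le_bot_iff.1 (h ▸ hed)), ?_, u ⊓ (sSup s)ᶜ, ?_, ?_⟩, hed⟩
  · exact isConnectedElement_sSup (fun x hx => hx.1) hes fun x hx => hx.2.2
  · refine le_antisymm (sup_le hdu inf_le_left) (hloc.le_of_forall fun x hx hxu => ?_)
    by_cases hm : x ⊓ sSup s = ⊥
    · exact le_sup_of_le_right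
        (le_inf hxu (le_compl_iff_disjoint_left.2 (disjoint_iff.2 (by rwa [inf_comm]))))
    · refine le_sup_of_le_left ?_
      rw [inf_sSup_eq] at hm
      obtain ⟨y, hy, hxy⟩ : ∃ y ∈ s, x ⊓ y ≠ ⊥ := by
        by_contra! hc
        exact hm (by simpa using hc)
      refine le_sup_left.trans (le_sSup (a := x ⊔ y) ⟨hx.sup hy.1 hxy, sup_le hxu hy.2.1, ?_⟩)
      exact fun h => hy.2.2 (le_bot_iff.1 (h ▸ inf_le_inf_right _ le_sup_right))
  · rw [inf_left_comm, inf_compl_self, inf_bot_eq]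

lemma IsLocallyConnected.le_of_forall_isComponent (hloc : IsLocallyConnected L) {u x : L}
    (h : ∀ d, IsComponent d u → d ≤ x) : u ≤ x := by
  refine hloc.le_of_forall fun e he heu => ?_
  by_cases h0 : e = ⊥
  · simp [h0]
  · obtain ⟨d, hd, hed⟩ := hloc.exists_isComponent he h0 heu
    exact hed.trans (h d hd)

/-- In a locally connected locale, an open sublocale `𝔬(p)` disjoint from the boundary of each `𝔬(d)`
for `d ∈ s` is disjoint from the boundary of their union. -/
lemma IsLocallyConnected.le_sSup_sup_compl (hloc : IsLocallyConnected L) {p : L} {s : Set L}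
    (h : ∀ d ∈ s, p ≤ d ⊔ dᶜ) : p ≤ sSup s ⊔ (sSup s)ᶜ := by
  refine hloc.le_of_forall fun e he hep => ?_
  by_cases hc : ∃ d ∈ s, e ≤ d
  · obtain ⟨d, hd, hed⟩ := hc
    exact le_sup_of_le_left (hed.trans (le_sSup hd))
  · push Not at hc
    refine le_sup_of_le_right (le_compl_comm.1 (sSup_le fun d hd => le_compl_comm.1 ?_))
    exact (he.le_or_le_of_le_sup_compl (hep.trans (h d hd))).resolve_left (hc d hd)

lemma IsConnected.eq_bot_or_eq_bot (hconn : IsConnected L) {x y : L} (h : x ⊔ y = ⊤)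
    (h0 : x ⊓ y = ⊥) : x = ⊥ ∨ y = ⊥ :=
  hconn x y h.symm h0

lemma IsConnected.eq_top_or_eq_top (hconn : IsConnected L) {x y : L} (h : x ⊔ y = ⊤)
    (h0 : x ⊓ y = ⊥) : x = ⊤ ∨ y = ⊤ := by
  rcases hconn x y h.symm h0 with rfl | rfl
  · exact Or.inr (by simpa using h)
  · exact Or.inl (by simpa using h)

lemma sup_compl_ne_top {a : L} (hconn : IsConnected L) (h0 : a ≠ ⊥) (h1 : a ≠ ⊤) :
    a ⊔ aᶜ ≠ ⊤ := by
  intro h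
  rcases hconn.eq_top_or_eq_top h (inf_compl_self a) with h2 | h2
  · exact h1 h2
  · exact h0 (le_compl_self.1 (h2 ▸ le_top))

/-! ### Connected closed sublocales -/

/-- The frame `↑a` of the closed sublocale `𝔠(a)`, whose bottom is `a`, is connected: its top is not
the join of two disjoint elements other than the top. -/
def IsCoconnected (a : L) : Prop := ∀ x y : L, x ⊓ y = a → x ⊔ y = ⊤ → x = ⊤ ∨ y = ⊤

lemma isCoconnected_top : IsCoconnected (⊤ : L) := fun _ _ h _ => Or.inl (inf_eq_top_iff.1 h).1

lemma IsCoconnected.sup_eq_top_or {a x y : L} (ha : IsCoconnected a) (h : x ⊓ y ≤ a)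
    (ht : a ⊔ (x ⊔ y) = ⊤) : a ⊔ x = ⊤ ∨ a ⊔ y = ⊤ :=
  ha _ _ (by rw [← sup_inf_left, sup_eq_left.2 h]) (by rw [← sup_sup_distrib_left, ht])

/-- In a connected locale, the complement of a component of the complement of a connected non-void
closed sublocale is connected. -/
lemma IsComponent.isCoconnected (hconn : IsConnected L) {d u : L} (h : IsComponent d u)
    (hu : IsCoconnected u) : IsCoconnected d := by
  have key : ∀ x y : L, x ⊓ y = d → x ⊔ y = ⊤ → u ⊔ y = ⊤ → x = ⊤ ∨ y = ⊤ := by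
    intro x y hxy ht huy
    obtain ⟨h0, -, e, hde, hde0⟩ := h
    have hdu : d ≤ u := hde ▸ le_sup_left
    have hdy : d ≤ y := hxy ▸ inf_le_right
    have hxu : x ≤ u := by
      have h1 : u ⊔ x ⊓ y = u := sup_eq_left.2 (hxy ▸ hdu)
      rw [sup_inf_left, huy, inf_top_eq] at h1
      exact h1 ▸ le_sup_right
    have h1 : x ⊓ e ⊔ y = ⊤ := by
      refine top_le_iff.1 (ht ▸ sup_le ?_ le_sup_right)
      exact le_of_le_sup_of_inf_le (hxu.trans hde.ge)
        (le_sup_of_le_right (inf_le_right.trans hdy)) le_sup_left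
    have h2 : x ⊓ e ⊓ y = ⊥ := by rw [inf_right_comm, hxy, hde0]
    rcases hconn.eq_bot_or_eq_bot h1 h2 with h3 | h3
    · exact Or.inr (by rwa [h3, bot_sup_eq] at h1)
    · exact absurd (le_bot_iff.1 (h3 ▸ hdy)) h0
  intro x y hxy ht
  rcases hu.sup_eq_top_or (hxy.le.trans h.le) (by rw [ht, sup_top_eq]) with h1 | h1
  · exact (key y x (by rw [inf_comm, hxy]) (by rw [sup_comm, ht]) h1).symm
  · exact key x y hxy ht h1

/-- The closure of a connected open sublocale is connected. -/
lemma IsConnectedElement.isCoconnected_compl {a : L} (ha : IsConnectedElement a) :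
    IsCoconnected aᶜ := by
  have key : ∀ x y : L, x ⊓ y = aᶜ → x ⊔ y = ⊤ → a ≤ x → x = ⊤ := by
    intro x y hxy ht hax
    have h1 : y ≤ aᶜ := by
      rw [le_compl_iff_disjoint_right, disjoint_iff, ← le_bot_iff, ← compl_inf_self a, ← hxy]
      exact le_inf (le_inf (inf_le_right.trans hax) inf_le_left) inf_le_right
    exact top_le_iff.1 (ht ▸ sup_le le_rfl (h1.trans (hxy ▸ inf_le_left)))
  intro x y hxy ht
  rcases ha.le_or_le (b := x) (c := y) (by simp [ht])
    (by rw [inf_assoc, hxy, inf_compl_self]) with h | h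
  · exact Or.inl (key x y hxy ht h)
  · exact Or.inr (key y x (by rw [inf_comm, hxy]) (by rw [sup_comm, ht]) h)

/-! ### Unicoherence and boundaries of components -/

/-- Suppose `𝔬(h)` lies in the connected closed sublocale `𝔠(k)`. If the boundary of each component
of `𝔬(h)` is connected, then `𝔠(h) ∩ 𝔠(k)` is connected. Indeed a splitting of `𝔠(h) ∩ 𝔠(k)` into
`P` and `Q` sorts the components of `𝔬(h)` by whether their boundary lies in `P` or in `Q`, and this
splits `𝔠(k) = 𝔬(h) ∪ (𝔠(h) ∩ 𝔠(k))`. -/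
lemma IsCoconnected.sup_of_forall_isComponent (hloc : IsLocallyConnected L) {h k : L}
    (h0 : h ⊓ k = ⊥) (hk : IsCoconnected k)
    (hd : ∀ d, IsComponent d h → IsCoconnected (d ⊔ dᶜ)) : IsCoconnected (h ⊔ k) := by
  intro p q hpq ht
  have hhp : h ≤ p := le_sup_left.trans (hpq ▸ inf_le_left)
  have hhq : h ≤ q := le_sup_left.trans (hpq ▸ inf_le_right)
  have hkp : k ≤ p := le_sup_right.trans (hpq ▸ inf_le_left)
  have hkq : k ≤ q := le_sup_right.trans (hpq ▸ inf_le_right)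
  have hkh : k ≤ hᶜ := le_compl_iff_disjoint_left.2 (disjoint_iff.2 h0)
  have hsort : ∀ d, IsComponent d h → p ≤ d ⊔ dᶜ ∨ q ≤ d ⊔ dᶜ := by
    intro d hdh
    have h1 : p ⊓ q ≤ d ⊔ dᶜ := hpq ▸ sup_le hdh.le_sup_compl
      (le_sup_of_le_right (hkh.trans (compl_le_compl hdh.le)))
    rcases (hd d hdh).sup_eq_top_or h1 (by rw [ht, sup_top_eq]) with h2 | h2
    · refine Or.inr ?_
      rw [← inf_top_eq q, ← h2, inf_sup_left, inf_comm q p]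
      exact sup_le inf_le_right h1
    · refine Or.inl ?_
      rw [← inf_top_eq p, ← h2, inf_sup_left]
      exact sup_le inf_le_right h1
  set m := sSup {d | IsComponent d h ∧ p ≤ d ⊔ dᶜ} with hm
  set n := sSup {d | IsComponent d h ∧ ¬ p ≤ d ⊔ dᶜ} with hn
  have hpm : p ≤ m ⊔ mᶜ := hloc.le_sSup_sup_compl fun d hd' => hd'.2
  have hqn : q ≤ n ⊔ nᶜ := hloc.le_sSup_sup_compl fun d hd' => (hsort d hd'.1).resolve_left hd'.2
  have hmh : m ≤ h := sSup_le fun d hd' => hd'.1.le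
  have hnh : n ≤ h := sSup_le fun d hd' => hd'.1.le
  have hmn : m ⊔ n = h := by
    refine le_antisymm (sup_le hmh hnh) (hloc.le_of_forall_isComponent fun d hd' => ?_)
    by_cases hc : p ≤ d ⊔ dᶜ
    · exact le_sup_of_le_left (le_sSup ⟨hd', hc⟩)
    · exact le_sup_of_le_right (le_sSup ⟨hd', hc⟩)
  have hmn0 : m ≤ nᶜ := by
    refine sSup_le fun d hd' => le_compl_comm.1 (sSup_le fun e he => ?_)
    rw [le_compl_iff_disjoint_left, disjoint_iff]
    by_contra hne
    have h1 := hd'.1.eq_of_inf_ne_bot he.1 hne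
    exact he.2 (h1 ▸ hd'.2)
  -- The closed sublocales `𝔠(p ⊓ mᶜ) = 𝔬(m) ∪ 𝔠(p)` and `𝔠(q ⊓ nᶜ) = 𝔬(n) ∪ 𝔠(q)` split `𝔠(k)`.
  have hx : k ≤ p ⊓ mᶜ := le_inf hkp (hkh.trans (compl_le_compl hmh))
  have hy : k ≤ q ⊓ nᶜ := le_inf hkq (hkh.trans (compl_le_compl hnh))
  have hxy : p ⊓ mᶜ ⊓ (q ⊓ nᶜ) = k := by
    refine le_antisymm ?_ (le_inf hx hy)
    rw [inf_inf_inf_comm, hpq, ← compl_sup, hmn, inf_sup_right, inf_compl_self, bot_sup_eq]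
    exact inf_le_left
  have hsup : p ⊓ mᶜ ⊔ q ⊓ nᶜ = ⊤ := by
    refine top_le_iff.1 (ht ▸ sup_le ?_ ?_)
    · exact le_of_le_sup_of_inf_le hpm
        (le_sup_of_le_right (inf_le_right.trans (le_inf (hmh.trans hhq) hmn0))) le_sup_left
    · exact le_of_le_sup_of_inf_le hqn
        (le_sup_of_le_left (inf_le_right.trans (le_inf (hnh.trans hhp) (le_compl_comm.1 hmn0))))
        le_sup_right
  rcases hk _ _ hxy hsup with h1 | h1
  · exact Or.inl (inf_eq_top_iff.1 h1).1
  · exact Or.inr (inf_eq_top_iff.1 h1).1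

/-- If disjoint components of an open sublocale that share their boundary have connected boundary,
then so does every connected open sublocale with connected complement. -/
lemma IsCoconnected.sup_compl_of_forall_disjoint (hloc : IsLocallyConnected L)
    (H : ∀ u d₁ d₂ : L, u ≠ ⊤ → IsComponent d₁ u → IsComponent d₂ u → d₁ ⊓ d₂ = ⊥ →
      d₁ ⊔ d₁ᶜ = d₂ ⊔ d₂ᶜ → IsCoconnected (d₁ ⊔ d₁ᶜ))
    {r : L} (hr : IsConnectedElement r) (hr' : IsCoconnected r) : IsCoconnected (r ⊔ rᶜ) := by
  by_cases h0 : r = ⊥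
  · simpa [h0] using isCoconnected_top
  rw [sup_comm]
  -- `d` is a component of the exterior of `r`, and `b` the component of the exterior of `d` that
  -- contains `r`; they have the same boundary.
  refine IsCoconnected.sup_of_forall_isComponent hloc (compl_inf_self r) hr' fun d hd => ?_
  obtain ⟨b, hb, hrb⟩ := hloc.exists_isComponent hr h0 (le_compl_comm.1 hd.le)
  by_cases htop : d ⊔ dᶜ = ⊤
  · rw [htop]
    exact isCoconnected_top
  have hbd : d ⊔ dᶜ = b ⊔ bᶜ := by
    refine le_antisymm (sup_le ?_ hb.le_sup_compl) (sup_le ?_ ?_)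
    · exact le_sup_of_le_right (le_compl_comm.1 hb.le)
    · exact le_sup_of_le_right hb.le
    · exact (compl_le_compl hrb).trans hd.le_sup_compl
  refine H (d ⊔ dᶜ) d b htop (.sup_compl_self hd.2.1 hd.1) (hbd ▸ .sup_compl_self hb.2.1 hb.1) ?_ hbd
  rw [← le_bot_iff, ← inf_compl_self d]
  exact inf_le_inf_left _ hb.le

/-- Open unicoherence makes the boundary of every connected open sublocale `𝔬(r)` with connected
complement connected. If `𝔠(p)` and `𝔠(q)` split the boundary, the components of `𝔬(p)` and `𝔬(q)`
that contain `𝔬(r)` cover the locale, and their intersection is `𝔬(r)` by open unicoherence; hence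
their traces split `𝔠(r)`. -/
lemma IsCoconnected.sup_compl_of_openUnicoherent (hconn : IsConnected L)
    (hloc : IsLocallyConnected L)
    (H : ∀ a b : L, IsConnectedElement a → IsConnectedElement b → a ⊔ b = ⊤ →
      IsConnectedElement (a ⊓ b))
    {r : L} (hr : IsConnectedElement r) (hr' : IsCoconnected r) : IsCoconnected (r ⊔ rᶜ) := by
  by_cases h0 : r = ⊥
  · simpa [h0] using isCoconnected_top
  have key : ∀ p q a b : L, p ⊓ q = r ⊔ rᶜ → p ⊔ q = ⊤ → q ≠ ⊤ → IsComponent a p →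
      IsComponent b q → r ≤ a → r ≤ b → p ≤ a ⊔ b := by
    intro p q a b hpq ht hq ha hb hra hrb
    have hrp : rᶜ ≤ p := le_sup_right.trans (hpq ▸ inf_le_left)
    have hrq : rᶜ ≤ q := le_sup_right.trans (hpq ▸ inf_le_right)
    refine hloc.le_of_forall_isComponent fun e he => ?_
    by_cases hea : e ⊓ a = ⊥
    swap
    · exact le_sup_of_le_left (ha.le_of_inf_ne_bot he.2.1 he.le hea)
    refine le_sup_of_le_right ?_
    have her : e ≤ rᶜ := le_compl_iff_disjoint_left.2
      ((disjoint_iff.2 (inf_comm e a ▸ hea)).mono_left hra)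
    obtain ⟨c, hc, hec⟩ := hloc.exists_isComponent he.2.1 he.1 (her.trans hrq)
    by_cases hcb : c ⊓ b = ⊥
    swap
    · exact hec.trans (hb.le_of_inf_ne_bot hc.2.1 hc.le hcb)
    -- Otherwise `e = c` is a component of both `p` and `q`, so its boundary is void.
    have hcr : c ≤ rᶜ := le_compl_iff_disjoint_left.2
      ((disjoint_iff.2 (inf_comm c b ▸ hcb)).mono_left hrb)
    have hce : c = e := le_antisymm (he.le_of_inf_ne_bot hc.2.1 (hcr.trans hrp)
      (by rw [inf_eq_right.2 hec]; exact he.1)) hec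
    have htop : e ⊔ eᶜ = ⊤ :=
      top_le_iff.1 (ht ▸ sup_le he.le_sup_compl (hce ▸ hc.le_sup_compl))
    exact (sup_compl_ne_top hconn he.1 (fun h => hq (top_le_iff.1 (h ▸ her.trans hrq))) htop).elim
  intro p q hpq ht
  by_contra! hne
  have hrp : r ≤ p := le_sup_left.trans (hpq ▸ inf_le_left)
  have hrq : r ≤ q := le_sup_left.trans (hpq ▸ inf_le_right)
  obtain ⟨a, ha, hra⟩ := hloc.exists_isComponent hr h0 hrp
  obtain ⟨b, hb, hrb⟩ := hloc.exists_isComponent hr h0 hrq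
  have hab : a ⊔ b = ⊤ := by
    refine top_le_iff.1 (ht ▸ sup_le (key p q a b hpq ht hne.2 ha hb hra hrb) ?_)
    rw [sup_comm]
    exact key q p b a (by rw [inf_comm, hpq]) (by rw [sup_comm, ht]) hne.1 hb ha hrb hra
  have hab' : a ⊓ b ≤ r := by
    refine ((H a b ha.2.1 hb.2.1 hab).le_or_le_of_le_sup_compl
      (hpq ▸ inf_le_inf ha.le hb.le)).resolve_right fun h1 => h0 ?_
    exact le_compl_self.1 ((le_inf hra hrb).trans h1)
  rcases hr' a b (le_antisymm hab' (le_inf hra hrb)) hab with h1 | h1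
  · exact hne.1 (top_le_iff.1 (h1 ▸ ha.le))
  · exact hne.2 (top_le_iff.1 (h1 ▸ hb.le))

/-- Suppose all connected open sublocales with connected complement have connected boundary. Then
two connected open sublocales with disjoint boundaries meet in a connected one. Otherwise take a
component `p` of the intersection and the component `d` of the exterior of `p` that contains another
part of the intersection. The connected boundary of `d` lies in the union of the boundaries of `a`
and `b`, hence in one of them, so that `d` splits the other one of `a`, `b`. -/
lemma IsConnectedElement.inf_of_forall_isCoconnected (hconn : IsConnected L)
    (hloc : IsLocallyConnected L)
    (H : ∀ r : L, IsConnectedElement r → IsCoconnected r → IsCoconnected (r ⊔ rᶜ))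
    {a b : L} (ha : IsConnectedElement a) (hb : IsConnectedElement b)
    (hab : a ⊔ aᶜ ⊔ (b ⊔ bᶜ) = ⊤) : IsConnectedElement (a ⊓ b) := by
  intro p' q hpq hpq0
  by_contra! hne
  obtain ⟨g, hg, hgp, hg0⟩ := hloc.exists_not_le (fun h => hne.1 (le_bot_iff.1 h))
  obtain ⟨f, hf, hfq, hf0⟩ := hloc.exists_not_le (fun h => hne.2 (le_bot_iff.1 h))
  rw [le_bot_iff] at hg0 hf0
  obtain ⟨p, hp', -⟩ := hloc.exists_isComponent hg hg0 hgp
  have hp : IsComponent p (a ⊓ b) := hpq ▸ hp'.sup_right hpq0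
  have hfp : f ≤ pᶜ := le_compl_iff_disjoint_left.2
    ((disjoint_iff.2 hpq0).mono hp'.le hfq)
  have hfab : f ≤ a ⊓ b := hfq.trans (hpq ▸ le_sup_right)
  obtain ⟨d, hd, hfd⟩ := hloc.exists_isComponent hf hf0 hfp
  have hpd : p ≤ dᶜ := le_compl_comm.1 hd.le
  have hT := H d hd.2.1 (hd.isCoconnected hconn hp.2.1.isCoconnected_compl)
  have hle : (a ⊔ aᶜ) ⊓ (b ⊔ bᶜ) ≤ d ⊔ dᶜ := by
    have h1 : p ⊔ pᶜ ≤ d ⊔ dᶜ := sup_le (le_sup_of_le_right hpd) hd.le_sup_compl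
    have ha' : aᶜ ≤ p ⊔ pᶜ :=
      (compl_le_compl (hp.le.trans inf_le_left)).trans le_sup_right
    have hb' : bᶜ ≤ p ⊔ pᶜ :=
      (compl_le_compl (hp.le.trans inf_le_right)).trans le_sup_right
    refine le_trans ?_ h1
    rw [inf_sup_left, inf_sup_right]
    exact sup_le (sup_le hp.le_sup_compl (inf_le_left.trans ha')) (inf_le_right.trans hb')
  have key : ∀ c, IsConnectedElement c → a ⊓ b ≤ c → c ≤ d ⊔ dᶜ → False := by
    intro c hc habc hcd
    rcases hc.le_or_le_of_le_sup_compl hcd with h1 | h1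
    · exact hp.1 (le_compl_self.1 ((hp.le.trans (habc.trans h1)).trans (le_compl_comm.1 hpd)))
    · exact hf0 (le_compl_self.1
        ((hfab.trans (habc.trans h1)).trans (compl_le_compl hfd)))
  rcases hT.sup_eq_top_or hle (by rw [hab, sup_top_eq]) with h1 | h1
  · refine key b hb inf_le_right (le_sup_left.trans (b := b ⊔ bᶜ) ?_)
    rw [← inf_top_eq (b ⊔ bᶜ), ← h1, inf_sup_left, inf_comm _ (a ⊔ aᶜ)]
    exact sup_le inf_le_right hle
  · refine key a ha inf_le_left (le_sup_left.trans (b := a ⊔ aᶜ) ?_)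
    rw [← inf_top_eq (a ⊔ aᶜ), ← h1, inf_sup_left]
    exact sup_le inf_le_right hle

end Order.Frame

/-! ### Connectedness of sublocales in terms of elements -/

namespace Sublocale

open Order.Frame

variable {L : Type u} [Order.Frame L] {S D : Sublocale L} {a b u x y : L}

lemma le_closedSub_sup_iff : S ≤ closedSub a ⊔ closedSub b ↔ a ⊓ b ≤ sInf (S : Set L) := by
  rw [closedSub_sup_closedSub, le_closedSub_iff]

/-- A connected sublocale covered by two closed sublocales that are disjoint on it is contained in
the complement of one of them. -/
lemma IsConnected.le_openSub_or (hS : S.IsConnected) (h : a ⊓ b ≤ sInf (S : Set L))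
    (h0 : S ≤ openSub (a ⊔ b)) : S ≤ openSub a ∨ S ≤ openSub b := by
  by_contra! hne
  rw [le_openSub_iff, ← closedSub_inf_closedSub, ← inf_assoc] at h0
  exact hS a b ⟨le_closedSub_sup_iff.2 h, h0, fun h => hne.1 (le_openSub_iff.2 h),
    fun h => hne.2 (le_openSub_iff.2 h)⟩

/-- The closure of a connected sublocale is connected. -/
lemma IsConnected.isCoconnected_sInf (hS : S.IsConnected) : IsCoconnected (sInf (S : Set L)) := by
  have key : ∀ x y : L, x ⊓ y = sInf (S : Set L) → x ⊔ y = ⊤ → S ≤ openSub x → x = ⊤ := by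
    intro x y hxy ht hx
    have hy : y ≤ sInf (S : Set L) := by
      rw [← le_closedSub_iff, ← inf_eq_left.2 (le_closedSub_sup_iff.2 hxy.le), inf_sup_left,
        le_openSub_iff.1 hx, bot_sup_eq]
      exact inf_le_right
    rw [← hxy] at hy
    exact top_le_iff.1 (ht ▸ sup_le le_rfl (hy.trans inf_le_left))
  intro x y hxy ht
  rcases hS.le_openSub_or hxy.le (by rw [ht, openSub_top]; exact le_top) with h | h
  · exact Or.inl (key x y hxy ht h)
  · exact Or.inr (key y x (by rw [inf_comm, hxy]) (by rw [sup_comm, ht]) h)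

lemma isConnected_closedSub_iff : (closedSub a).IsConnected ↔ IsCoconnected a := by
  refine ⟨fun h => by simpa only [sInf_closedSub] using h.isCoconnected_sInf, ?_⟩
  rintro h x y ⟨h1, h2, h3, h4⟩
  rw [le_closedSub_sup_iff, sInf_closedSub] at h1
  rw [inf_assoc, closedSub_inf_closedSub, closedSub_inf_closedSub, closedSub_eq_bot_iff] at h2
  rw [closedSub_inf_closedSub, Ne, closedSub_eq_bot_iff] at h3 h4
  exact (h.sup_eq_top_or h1 h2).elim h3 h4

lemma isSeparation_openSub_iff : (openSub u).IsSeparation a b ↔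
    u ⊓ a ⊓ b = ⊥ ∧ u ≤ a ⊔ b ∧ ¬ u ≤ a ∧ ¬ u ≤ b := by
  rw [IsSeparation, inf_assoc, closedSub_inf_closedSub, ← le_openSub_iff, Ne, Ne,
    ← le_openSub_iff, ← le_openSub_iff, openSub_le_openSub, openSub_le_openSub,
    openSub_le_openSub, le_closedSub_sup_iff, sInf_openSub, le_compl_iff_disjoint_left,
    disjoint_iff, inf_assoc]

lemma isConnected_openSub_iff : (openSub a).IsConnected ↔ IsConnectedElement a := by
  constructor
  · intro h x y hxy h0
    by_contra! hne
    refine h x y (isSeparation_openSub_iff.2 ⟨?_, hxy.le, fun hx => hne.2 ?_, fun hy => hne.1 ?_⟩)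
    · rw [inf_assoc, h0, inf_bot_eq]
    · rw [← le_bot_iff, ← h0]
      exact le_inf ((le_sup_right.trans hxy.ge).trans hx) le_rfl
    · rw [← le_bot_iff, ← h0]
      exact le_inf le_rfl ((le_sup_left.trans hxy.ge).trans hy)
  · intro h x y hs
    obtain ⟨h1, h2, h3, h4⟩ := isSeparation_openSub_iff.1 hs
    exact (h.le_or_le h2 h1).elim h3 h4

lemma isContinuum_closedSub_iff : (closedSub a).IsContinuum ↔ a ≠ ⊤ ∧ IsCoconnected a := by
  rw [IsContinuum, isConnected_closedSub_iff, Ne, closedSub_eq_bot_iff]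
  exact ⟨fun h => ⟨h.1, h.2.2⟩, fun h => ⟨h.1, ⟨a, rfl⟩, h.2⟩⟩

lemma isRegion_openSub_iff : (openSub a).IsRegion ↔ a ≠ ⊥ ∧ IsConnectedElement a := by
  rw [IsRegion, isConnected_openSub_iff, Ne, openSub_eq_bot_iff]
  exact ⟨fun h => ⟨h.1, h.2.2⟩, fun h => ⟨h.1, ⟨a, rfl⟩, h.2⟩⟩

lemma isSimple_openSub_iff :
    (openSub a).IsSimple ↔ IsConnectedElement a ∧ IsCoconnected a := by
  rw [IsSimple, top_sdiff_openSub, isConnected_openSub_iff, isConnected_closedSub_iff]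
  exact and_iff_right ⟨_, isCompl_openSub_closedSub a⟩

lemma IsSimple.exists_isCompl {C : Sublocale L} (h : C.IsSimple) :
    ∃ D, IsCompl C D ∧ C.IsConnected ∧ D.IsConnected := by
  obtain ⟨⟨D, hD⟩, h1, h2⟩ := h
  exact ⟨D, hD, h1, top_sdiff_eq_of_isCompl hD ▸ h2⟩

lemma isComponentOf_openSub {d : L} (h : IsComponent d u) :
    (openSub d).IsComponentOf (openSub u) := by
  obtain ⟨h0, hd, e, rfl, hde⟩ := h
  refine ⟨by rwa [Ne, openSub_eq_bot_iff], openSub_le_openSub.2 le_sup_left,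
    isConnected_openSub_iff.2 hd, fun S hS hc hne => ?_⟩
  refine (hc.le_openSub_or (by rw [hde]; exact bot_le) hS).resolve_right fun h => hne ?_
  rw [← le_bot_iff]
  refine (inf_le_inf_right _ h).trans ?_
  rw [openSub_inf_openSub, inf_comm, hde, openSub_bot]

lemma exists_inf_openSub_ne_bot (hloc : IsLocallyConnected L) (h0 : S ≠ ⊥)
    (hS : S ≤ openSub u) : ∃ d, IsComponent d u ∧ S ⊓ openSub d ≠ ⊥ := by
  by_contra! hc
  have h : u ≤ sInf (S : Set L) := hloc.le_of_forall_isComponent fun d hd => by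
    rw [← le_closedSub_iff, le_closedSub_iff_inf_openSub, hc d hd]
  rw [← le_closedSub_iff] at h
  refine h0 (le_bot_iff.1 ?_)
  rw [← (isCompl_openSub_closedSub u).inf_eq_bot]
  exact le_inf hS h

lemma isComponentOf_openSub_iff (hloc : IsLocallyConnected L) :
    D.IsComponentOf (openSub u) ↔ ∃ d, IsComponent d u ∧ D = openSub d := by
  constructor
  · rintro ⟨h0, hle, hc, hmax⟩
    obtain ⟨d, hd, hne⟩ := exists_inf_openSub_ne_bot hloc h0 hle
    have hd' := isComponentOf_openSub hd
    refine ⟨d, hd, le_antisymm (hd'.2.2.2 D hle hc hne) ?_⟩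
    exact hmax _ hd'.2.1 hd'.2.2.1 (by rwa [inf_comm])
  · rintro ⟨d, hd, rfl⟩
    exact isComponentOf_openSub hd

lemma mem_inf_closedSub_iff : x ∈ openSub u ⊓ closedSub a ↔ u ⇨ x = x ∧ a ≤ x :=
  mem_inf_iff

lemma separatesElements_closedSub_iff : (closedSub u).SeparatesElements x y ↔
    ∃ a b, (u ⊓ a ⊓ b = ⊥ ∧ u ≤ a ⊔ b ∧ ¬ u ≤ a ∧ ¬ u ≤ b) ∧
      (u ⇨ x = x ∧ a ≤ x) ∧ (u ⇨ y = y ∧ b ≤ y) := by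
  simp only [SeparatesElements, top_sdiff_closedSub, isSeparation_openSub_iff,
    mem_inf_closedSub_iff]

/-! ### Separation of sublocales -/

/-- If `𝔠(u)` does not separate `e ⇨ x` and `f ⇨ y`, the traces of `x` on `𝔬(e)` and of `y` on
`𝔬(f)`, then the connected open sublocales `𝔬(e)` and `𝔬(f)` lie in one component of `𝔬(u)`. -/
lemma exists_isComponent_of_not_separatesElements (hloc : IsLocallyConnected L) {e f : L}
    (he : IsConnectedElement e) (hf : IsConnectedElement f) (heu : e ≤ u) (hfu : f ≤ u)
    (hex : ¬ e ≤ x) (hfy : ¬ f ≤ y) (h : ¬ (closedSub u).SeparatesElements (e ⇨ x) (f ⇨ y)) :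
    ∃ d, IsComponent d u ∧ e ≤ d ∧ f ≤ d := by
  have he0 : e ≠ ⊥ := fun h => hex (h ▸ bot_le)
  obtain ⟨d, hd, hed⟩ := hloc.exists_isComponent he he0 heu
  refine ⟨d, hd, hed, ?_⟩
  obtain ⟨-, -, c, rfl, h0⟩ := id hd
  refine (hf.le_or_le hfu (by rw [inf_assoc, h0, inf_bot_eq])).resolve_right fun hfc => h ?_
  have hec : e ⊓ c = ⊥ := le_bot_iff.1 (h0 ▸ inf_le_inf_right c hed)
  have hfd : f ⊓ d = ⊥ := le_bot_iff.1 (h0 ▸ inf_comm f d ▸ inf_le_inf_left d hfc)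
  have hx : c ≤ e ⇨ x := by rw [_root_.le_himp_iff, inf_comm, hec]; exact bot_le
  have hy : d ≤ f ⇨ y := by rw [_root_.le_himp_iff, inf_comm, hfd]; exact bot_le
  refine separatesElements_closedSub_iff.2 ⟨c, d, ⟨?_, ?_, ?_, ?_⟩, ⟨?_, hx⟩, ?_, hy⟩
  · rw [inf_assoc, inf_comm c d, h0, inf_bot_eq]
  · rw [sup_comm]
  · intro hle
    exact he0 (le_bot_iff.1 (hec ▸ le_inf le_rfl (heu.trans hle)))
  · intro hle
    exact hfy (le_bot_iff.1 (hfd ▸ le_inf le_rfl (hfu.trans hle)) ▸ bot_le)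
  · rw [himp_himp, inf_eq_right.2 heu]
  · rw [himp_himp, inf_eq_right.2 hfu]

/-- If connected open sublocales with disjoint boundaries have connected intersections, then the
union of disjoint closed sublocales `𝔠(u)`, `𝔠(v)` separates only what one of them separates: the
components of `𝔬(u)` and `𝔬(v)` that contain given parts of `X` and `Y` have disjoint boundaries, so
their intersection connects these parts in `𝔬(u ⊓ v)`. -/
lemma not_separates_of_forall_inf (hloc : IsLocallyConnected L)
    (H : ∀ a b : L, IsConnectedElement a → IsConnectedElement b → a ⊔ aᶜ ⊔ (b ⊔ bᶜ) = ⊤ →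
      IsConnectedElement (a ⊓ b))
    {X Y : Sublocale L} {u v : L} (hX : X ≠ ⊥) (hY : Y ≠ ⊥) (huv : u ⊔ v = ⊤)
    (h : ∀ x ∈ X, x ≠ ⊤ → ∀ y ∈ Y, y ≠ ⊤ →
      ¬ (closedSub u).SeparatesElements x y ∧ ¬ (closedSub v).SeparatesElements x y) :
    ¬ (closedSub u ⊔ closedSub v).Separates X Y := by
  intro hsep
  obtain ⟨x, hxX, hx⟩ := ne_bot_iff.1 hX
  obtain ⟨y, hyY, hy⟩ := ne_bot_iff.1 hY
  have hxy := hsep x hxX y hyY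
  rw [closedSub_sup_closedSub, separatesElements_closedSub_iff] at hxy
  obtain ⟨a, b, ⟨h0, hle, -, -⟩, ⟨hwx, hax⟩, hwy, hby⟩ := hxy
  have key : ∀ c d z : L, u ⊓ v ≤ c ⊔ d → u ⊓ v ⇨ z = z → c ≤ z → z ≠ ⊤ →
      ¬ u ⊓ v ⊓ d ≤ z := by
    intro c d z hcd hwz hcz hz hdz
    exact hz (hwz ▸ himp_eq_top_iff.2 (le_of_le_sup_of_inf_le hcd (inf_le_right.trans hcz) hdz))
  obtain ⟨e, he, heb, hex⟩ := hloc.exists_not_le (key a b x hle hwx hax hx)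
  obtain ⟨f, hf, hfa, hfy⟩ := hloc.exists_not_le (key b a y (sup_comm a b ▸ hle) hwy hby hy)
  have hns := h (e ⇨ x) (himp_mem hxX) (fun h => hex (himp_eq_top_iff.1 h))
    (f ⇨ y) (himp_mem hyY) (fun h => hfy (himp_eq_top_iff.1 h))
  have hew := heb.trans inf_le_left
  have hfw := hfa.trans inf_le_left
  obtain ⟨c, hc, hec, hfc⟩ := exists_isComponent_of_not_separatesElements hloc he hf
    (hew.trans inf_le_left) (hfw.trans inf_le_left) hex hfy hns.1
  obtain ⟨d, hd, hed, hfd⟩ := exists_isComponent_of_not_separatesElements hloc he hf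
    (hew.trans inf_le_right) (hfw.trans inf_le_right) hex hfy hns.2
  have hcd := H c d hc.2.1 hd.2.1
    (top_le_iff.1 (huv ▸ sup_le_sup hc.le_sup_compl hd.le_sup_compl))
  have hcw : c ⊓ d ≤ u ⊓ v := inf_le_inf hc.le hd.le
  rcases hcd.le_or_le (hcw.trans hle)
    (le_bot_iff.1 (h0 ▸ inf_le_inf_right _ (inf_le_inf_right _ hcw))) with h1 | h1
  · refine hex (le_trans ?_ (bot_le : ⊥ ≤ x))
    rw [← h0, inf_right_comm]
    exact le_inf heb ((le_inf hec hed).trans h1)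
  · refine hfy (le_trans ?_ (bot_le : ⊥ ≤ y))
    rw [← h0]
    exact le_inf hfa ((le_inf hfc hfd).trans h1)

/-- If `𝔠(a)` and `𝔠(b)` were disjoint with connected complements, and `𝔬(a ⊓ b)` disconnected, then
the two parts of `𝔬(a ⊓ b)` would be separated by the union of `𝔠(a)` and `𝔠(b)`, while neither of
these separates anything. -/
lemma isConnectedElement_inf_of_not_separates
    (H : ∀ (X Y : Sublocale L) (u v : L), X ≠ ⊥ → Y ≠ ⊥ → closedSub u ⊓ closedSub v = ⊥ →
      (∀ x ∈ X, x ≠ ⊤ → ∀ y ∈ Y, y ≠ ⊤ →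
        ¬ (closedSub u).SeparatesElements x y ∧ ¬ (closedSub v).SeparatesElements x y) →
      ¬ (closedSub u ⊔ closedSub v).Separates X Y)
    (ha : IsConnectedElement a) (hb : IsConnectedElement b) (hab : a ⊔ b = ⊤) :
    IsConnectedElement (a ⊓ b) := by
  have hns : ∀ c, IsConnectedElement c → ∀ x y : L, ¬ (closedSub c).SeparatesElements x y := by
    rintro c hc x y ⟨s, t, hst, -⟩
    rw [top_sdiff_closedSub] at hst
    exact isConnected_openSub_iff.2 hc s t hst
  intro p q hpq h0
  by_contra! hne
  refine H (openSub p) (openSub q) a b (by rw [Ne, openSub_eq_bot_iff]; exact hne.1)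
    (by rw [Ne, openSub_eq_bot_iff]; exact hne.2)
    (by rw [closedSub_inf_closedSub, hab, closedSub_top])
    (fun x _ _ y _ _ => ⟨hns a ha x y, hns b hb x y⟩) fun x hx y hy => ?_
  rw [mem_openSub_iff] at hx hy
  rw [closedSub_sup_closedSub, separatesElements_closedSub_iff, hpq]
  have hqx : q ≤ x := by rw [← hx, _root_.le_himp_iff, inf_comm, h0]; exact bot_le
  have hpy : p ≤ y := by rw [← hy, _root_.le_himp_iff, h0]; exact bot_le
  refine ⟨q, p, ⟨?_, by rw [sup_comm], ?_, ?_⟩, ⟨?_, hqx⟩, ?_, hpy⟩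
  · rw [inf_assoc, inf_comm q, h0, inf_bot_eq]
  · intro h
    exact hne.1 (le_bot_iff.1 (h0 ▸ le_inf le_rfl (le_sup_left.trans h)))
  · intro h
    exact hne.2 (le_bot_iff.1 (h0 ▸ le_inf (le_sup_right.trans h) le_rfl))
  · rw [sup_himp_distrib, hx, himp_eq_top_iff.2 hqx, inf_top_eq]
  · rw [sup_himp_distrib, hy, himp_eq_top_iff.2 hpy, top_inf_eq]

/-! ### Boundaries of complemented sublocales and unicoherence -/

/-- In a connected unicoherent locale, let `C` and `D` be disjoint connected sublocales with
`∂C ⊆ ∂D` and `E` the complement of `C`. Then the closure of `E` is connected, since a part of it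
disjoint from the closure of `D` would be disjoint from `∂C`, hence a summand of the whole locale;
and unicoherence applies to the closures of `C` and `E`. -/
lemma isConnected_boundary_of_unicoherent (hconn : Order.Frame.IsConnected L)
    (H : ∀ h k : L, h ≠ ⊤ → k ≠ ⊤ → IsCoconnected h → IsCoconnected k → h ⊓ k = ⊥ →
      IsCoconnected (h ⊔ k))
    {C D E : Sublocale L} (hCE : IsCompl C E) (hC : C.IsConnected) (hD : D.IsConnected)
    (hCD : C ⊓ D = ⊥) (hle : C.boundary ≤ D.boundary) : C.boundary.IsConnected := by
  rw [boundary_eq_of_isCompl hCE] at hle ⊢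
  rw [isConnected_closedSub_iff]
  have hDE : D ≤ E := by
    rw [← hCE.symm.disjoint_right_iff, disjoint_comm, disjoint_iff]
    exact hCD
  set h := sInf (C : Set L) with hh
  set k := sInf (E : Set L) with hk
  set m := sInf (D : Set L) with hm
  have hkm : k ≤ m := sInf_le_sInf hDE
  have hmhk : m ≤ h ⊔ k := closedSub_le_closedSub.1 (hle.trans (boundary_le_closure D))
  have hhk : h ⊓ k = ⊥ := by
    rw [← closedSub_eq_top_iff, ← top_le_iff, ← closedSub_sup_closedSub, ← hCE.sup_eq_top]
    exact sup_le_sup (le_closedSub_iff.2 le_rfl) (le_closedSub_iff.2 le_rfl)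
  by_cases h1 : h = ⊤
  · rw [h1, top_sup_eq]
    exact isCoconnected_top
  by_cases k1 : k = ⊤
  · rw [k1, sup_top_eq]
    exact isCoconnected_top
  refine H h k h1 k1 hC.isCoconnected_sInf ?_ hhk
  have key : ∀ x y : L, x ⊓ y = k → x ⊔ y = ⊤ → m ⊔ x = ⊤ → x = ⊤ := by
    intro x y hxy ht hmx
    have hhx : h ⊔ x = ⊤ := by
      refine top_le_iff.1 (hmx ▸ sup_le (hmhk.trans (sup_le le_sup_left ?_)) le_sup_right)
      exact le_sup_of_le_right (hxy ▸ inf_le_left)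
    have h2 : x ⊔ h ⊓ y = ⊤ := by rw [sup_inf_left, sup_comm x h, hhx, ht, inf_top_eq]
    have h3 : x ⊓ (h ⊓ y) = ⊥ := by rw [inf_left_comm, hxy, hhk]
    rcases hconn.eq_top_or_eq_top h2 h3 with h4 | h4
    · exact h4
    · exact absurd (inf_eq_top_iff.1 h4).1 h1
  intro x y hxy ht
  rcases hD.isCoconnected_sInf.sup_eq_top_or (hxy.le.trans hkm) (by rw [ht, sup_top_eq])
    with h2 | h2
  · exact Or.inl (key x y hxy ht h2)
  · exact Or.inr (key y x (by rw [inf_comm, hxy]) (by rw [sup_comm, ht]) h2)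

end Sublocale

/-! ### The equivalence -/

open Sublocale Order.Frame in
theorem theorem5p1 (L : Type u) [Order.Frame L]
    (hconn : Order.Frame.IsConnected L) (hloc : Order.Frame.IsLocallyConnected L) :
    List.TFAE [
      -- (I)
      ∀ (X Y : Sublocale L) (u v : L), X ≠ ⊥ → Y ≠ ⊥ →
        Sublocale.closedSub u ⊓ Sublocale.closedSub v = ⊥ →
        (∀ x ∈ X, x ≠ ⊤ → ∀ y ∈ Y, y ≠ ⊤ →
          ¬ (Sublocale.closedSub u).SeparatesElements x y ∧
          ¬ (Sublocale.closedSub v).SeparatesElements x y) →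
        ¬ (Sublocale.closedSub u ⊔ Sublocale.closedSub v).Separates X Y,
      -- (II) Brouwer property
      ∀ u : L, (Sublocale.closedSub u).IsContinuum →
        ∀ D : Sublocale L, D.IsComponentOf (⊤ \ Sublocale.closedSub u) → D.boundary.IsContinuum,
      -- (III) unicoherence
      Order.Frame.IsUnicoherent L,
      -- (IV)
      ∀ u : L, Sublocale.closedSub u ≠ ⊥ →
        ∀ D₁ D₂ : Sublocale L, D₁.IsComponentOf (⊤ \ Sublocale.closedSub u) →
          D₂.IsComponentOf (⊤ \ Sublocale.closedSub u) → D₁ ⊓ D₂ = ⊥ →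
          D₁.boundary = D₂.boundary → D₁.boundary.IsContinuum,
      -- (V)
      ∀ C D : Sublocale L, IsComplemented C → IsComplemented D → C.IsConnected → D.IsConnected →
        C ⊓ D = ⊥ → C.boundary ≤ D.boundary → C.boundary.IsConnected,
      -- (VI)
      ∀ C : Sublocale L, C.IsSimple → C.boundary.IsConnected,
      -- (VII)
      ∀ R : Sublocale L, R.IsSimple → R.IsRegion → R.boundary.IsConnected,
      -- (VIII)
      ∀ A B : Sublocale L, A.IsRegion → B.IsRegion → A ⊓ B = ⊥ →
        A.boundary = B.boundary → A.boundary.IsConnected,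
      -- (IX)
      ∀ A B : Sublocale L, A.IsRegion → B.IsRegion →
        A.boundary ⊓ B.boundary = ⊥ → (A ⊓ B).IsConnected,
      -- (X) open unicoherence
      Order.Frame.IsOpenUnicoherent L] := by
  have hsimple : (∀ R : Sublocale L, R.IsSimple → R.IsRegion → R.boundary.IsConnected) ↔
      ∀ r : L, IsConnectedElement r → IsCoconnected r → IsCoconnected (r ⊔ rᶜ) := by
    constructor
    · intro H r hr hr'
      by_cases h0 : r = ⊥
      · simpa [h0] using isCoconnected_top
      rw [← isConnected_closedSub_iff, ← boundary_openSub]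
      exact H _ (isSimple_openSub_iff.2 ⟨hr, hr'⟩) (isRegion_openSub_iff.2 ⟨h0, hr⟩)
    · rintro H R hR ⟨-, ⟨r, rfl⟩, -⟩
      rw [boundary_openSub, isConnected_closedSub_iff]
      exact H r (isSimple_openSub_iff.1 hR).1 (isSimple_openSub_iff.1 hR).2
  rw [hsimple]
  tfae_have 3 → 5 := by
    rintro H C D ⟨E, hE⟩ - hC hD hCD hle
    refine isConnected_boundary_of_unicoherent hconn (fun h k h1 k1 hh hk hhk => ?_)
      hE hC hD hCD hle
    have h2 := H (closedSub h) (closedSub k) (isContinuum_closedSub_iff.2 ⟨h1, hh⟩)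
      (isContinuum_closedSub_iff.2 ⟨k1, hk⟩)
      (by rw [closedSub_sup_closedSub, hhk, closedSub_bot])
    rw [closedSub_inf_closedSub, isContinuum_closedSub_iff] at h2
    exact h2.2
  tfae_have 5 → 6 := by
    intro H C hC
    obtain ⟨D, hCD, h1, h2⟩ := hC.exists_isCompl
    refine H C D ⟨_, hCD⟩ ⟨_, hCD.symm⟩ h1 h2 hCD.inf_eq_bot ?_
    rw [boundary_eq_of_isCompl hCD, boundary_eq_of_isCompl hCD.symm, sup_comm]
  tfae_have 6 → 7 := fun H => hsimple.1 fun R hR _ => H R hR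
  tfae_have 7 → 3 := by
    rintro H _ _ ⟨h0, ⟨h, rfl⟩, hh⟩ ⟨k0, ⟨k, rfl⟩, hk⟩ ht
    rw [isConnected_closedSub_iff] at hh hk
    rw [Ne, closedSub_eq_bot_iff] at h0 k0
    rw [closedSub_sup_closedSub, eq_comm, closedSub_eq_top_iff] at ht
    rw [closedSub_inf_closedSub, isContinuum_closedSub_iff]
    refine ⟨fun h1 => (hconn.eq_top_or_eq_top h1 ht).elim h0 k0, ?_⟩
    exact hk.sup_of_forall_isComponent hloc ht
      fun d hd => H d hd.2.1 (hd.isCoconnected hconn hh)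
  tfae_have 7 → 2 := by
    intro H u hu D hD
    rw [top_sdiff_closedSub, isComponentOf_openSub_iff hloc] at hD
    obtain ⟨d, hd, rfl⟩ := hD
    rw [isContinuum_closedSub_iff] at hu
    rw [boundary_openSub, isContinuum_closedSub_iff]
    refine ⟨?_, H d hd.2.1 (hd.isCoconnected hconn hu.2)⟩
    exact sup_compl_ne_top hconn hd.1 fun h => hu.1 (top_le_iff.1 (h ▸ hd.le))
  tfae_have 2 → 7 := by
    intro H r hr hr'
    by_cases h0 : r = ⊥
    · simpa [h0] using isCoconnected_top
    by_cases h1 : r = ⊤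
    · simpa [h1] using isCoconnected_top
    have h2 := H r (isContinuum_closedSub_iff.2 ⟨h1, hr'⟩) (openSub r)
      (by rw [top_sdiff_closedSub]; exact isComponentOf_openSub (.self hr h0))
    rw [boundary_openSub, isContinuum_closedSub_iff] at h2
    exact h2.2
  tfae_have 5 → 8 := by
    rintro H _ _ ⟨-, ⟨a, rfl⟩, ha⟩ ⟨-, ⟨b, rfl⟩, hb⟩ hab hbd
    exact H _ _ ⟨_, isCompl_openSub_closedSub a⟩
      ⟨_, isCompl_openSub_closedSub b⟩ ha hb hab hbd.le
  tfae_have 8 → 4 := by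
    intro H u hu D₁ D₂ hD₁ hD₂ h0 hbd
    rw [top_sdiff_closedSub, isComponentOf_openSub_iff hloc] at hD₁ hD₂
    obtain ⟨d₁, hd₁, rfl⟩ := hD₁
    obtain ⟨d₂, hd₂, rfl⟩ := hD₂
    rw [Ne, closedSub_eq_bot_iff] at hu
    have h1 := H _ _ (isRegion_openSub_iff.2 ⟨hd₁.1, hd₁.2.1⟩)
      (isRegion_openSub_iff.2 ⟨hd₂.1, hd₂.2.1⟩) h0 hbd
    rw [boundary_openSub, isConnected_closedSub_iff] at h1
    rw [boundary_openSub, isContinuum_closedSub_iff]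
    exact ⟨sup_compl_ne_top hconn hd₁.1 fun h => hu (top_le_iff.1 (h ▸ hd₁.le)), h1⟩
  tfae_have 4 → 7 := by
    intro H r hr hr'
    refine IsCoconnected.sup_compl_of_forall_disjoint hloc (fun u d₁ d₂ hu hd₁ hd₂ h0 hbd => ?_)
      hr hr'
    have h1 := H u (by rwa [Ne, closedSub_eq_bot_iff]) (openSub d₁) (openSub d₂)
      (by rw [top_sdiff_closedSub]; exact isComponentOf_openSub hd₁)
      (by rw [top_sdiff_closedSub]; exact isComponentOf_openSub hd₂)
      (by rw [openSub_inf_openSub, h0, openSub_bot])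
      (by rw [boundary_openSub, boundary_openSub, hbd])
    rw [boundary_openSub, isContinuum_closedSub_iff] at h1
    exact h1.2
  tfae_have 7 → 9 := by
    rintro H _ _ ⟨-, ⟨a, rfl⟩, ha⟩ ⟨-, ⟨b, rfl⟩, hb⟩ hab
    rw [isConnected_openSub_iff] at ha hb
    rw [boundary_openSub, boundary_openSub, closedSub_inf_closedSub, closedSub_eq_bot_iff] at hab
    rw [openSub_inf_openSub, isConnected_openSub_iff]
    exact ha.inf_of_forall_isCoconnected hconn hloc H hb hab
  tfae_have 9 → 1 := by
    intro H X Y u v hX hY huv h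
    rw [closedSub_inf_closedSub, closedSub_eq_bot_iff] at huv
    refine not_separates_of_forall_inf hloc (fun a b ha hb hab => ?_) hX hY huv h
    by_cases ha0 : a = ⊥
    · rwa [ha0, bot_inf_eq, ← ha0]
    by_cases hb0 : b = ⊥
    · rwa [hb0, inf_bot_eq, ← hb0]
    have h1 := H (openSub a) (openSub b) (isRegion_openSub_iff.2 ⟨ha0, ha⟩)
      (isRegion_openSub_iff.2 ⟨hb0, hb⟩) (by
        rw [boundary_openSub, boundary_openSub, closedSub_inf_closedSub, hab, closedSub_top])
    rwa [openSub_inf_openSub, isConnected_openSub_iff] at h1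
  tfae_have 1 → 10 := by
    rintro H _ _ ⟨a0, ⟨a, rfl⟩, ha⟩ ⟨b0, ⟨b, rfl⟩, hb⟩ hab
    rw [isConnected_openSub_iff] at ha hb
    rw [Ne, openSub_eq_bot_iff] at a0 b0
    rw [openSub_sup_openSub, ← openSub_top, openSub_injective.eq_iff] at hab
    rw [openSub_inf_openSub, isRegion_openSub_iff]
    exact ⟨fun h => (hconn.eq_bot_or_eq_bot hab.symm h).elim a0 b0,
      isConnectedElement_inf_of_not_separates H ha hb hab.symm⟩
  tfae_have 10 → 7 := by
    intro H r hr hr'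
    refine IsCoconnected.sup_compl_of_openUnicoherent hconn hloc (fun a b ha hb hab => ?_) hr hr'
    by_cases ha0 : a = ⊥
    · rwa [ha0, bot_inf_eq, ← ha0]
    by_cases hb0 : b = ⊥
    · rwa [hb0, inf_bot_eq, ← hb0]
    have h1 := H (openSub a) (openSub b) (isRegion_openSub_iff.2 ⟨ha0, ha⟩)
      (isRegion_openSub_iff.2 ⟨hb0, hb⟩) (by rw [openSub_sup_openSub, hab, openSub_top])
    rw [openSub_inf_openSub, isRegion_openSub_iff] at h1
    exact h1.2
  tfae_finish
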